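/- Let $K$ be a field of characteristic $p>0$ and let $L/K$ be a finite normal field extension which is modular, i.e. isomorphic to a tensor product over $K$ of extensions generated by one element. Let $e\ge 0$ be an integer such that $a^{p^e}$ is separable over $K$ for all $a\in L$ (for instance the exponent of $L/K$). For $F\in\{K,L\}$ put $F[\bar X]=F[X]/(X^{p^e})$, and let $\mathrm{HG}(L/K)=\mathrm{Aut}(L[\bar X]/K[\bar X])$ be the Heerema–Galois group. Then there is a decomposition $$L=K(\alpha_0)\otimes_K K(\alpha_1)\otimes_K\cdots\otimes_K K(\alpha_m)$$ with $\alpha_0$ separable over $K$ and, for $i=1,\dots,m$, $\alpha_i$ a $p^{n_i}$-th root of some $a_i\in K$ with $[K(\alpha_i):K]=p^{n_i}$. Given any such decomposition, let $G$ be the Galois group of $K(\alpha_0)/K$, let $H_0=K[G]$, and for $1\le i\le m$ let $H_i$ be the $K$-algebra with generators $D_i^{(k)}$, $0\le k<p^{n_i}$, and relations $D_i^{(0)}=1$, $D_i^{(h)}D_i^{(k)}=\binom{h+k}{h}D_i^{(h+k)}$ if $h+k<p^{n_i}$, and $D_i^{(h)}D_i^{(k)}=0$ otherwise. The Galois–Hopf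 algebra $\mathrm{GHA}(L/K)=H_0\otimes_K H_1\otimes_K\cdots\otimes_K H_m$ acts $K$-linearly on $L$, factor by factor, where $g\in G$ acts on $K(\alpha_0)$ as $g$ and $D_i^{(k)}(\alpha_i^l)=\binom{l}{k}\alpha_i^{l-k}$ for $0\le l<p^{n_i}$. For a $K$-vector space $V$ it acts on $L\otimes_K V$ through the factor $L$, and $\mathrm{HG}(L/K)$ acts on $L[\bar X]\otimes_K V$ through the factor $L[\bar X]$. Let $V$ be any $K$-vector space and let $W\subset L\otimes_K V$ be an $L$-subspace. The following are equivalent: (i) $W$ is defined over $K$: there is a $K$-subspace $W_0\subset V$ with $W=L\otimes_K W_0$; (ii) $W$ is stable under the action of $\mathrm{GHA}(L/K)$ on $L\otimes_K V$; (iii) $W\otimes_L L[\bar X]$ is stable under the action of $\mathrm{HG}(L/K)$ on $(L\otimes_K V)\otimes_L L[\bar X]=L[\bar X]\otimes_K V$. -/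

import Mathlib

open Polynomial IntermediateField
open scoped TensorProduct

noncomputable section

/-! ### Modular extensions -/

section Modular

variable {K L : Type*} [Field K] [Field L] [Algebra K L]

/-- The multiplication map `K(α₁) ⊗ ⋯ ⊗ K(αᵣ) → L`, all tensor products over `K`. -/
def adjoinTensorMul {r : ℕ} (α : Fin r → L) : (⨂[K] i, K⟮α i⟯) →ₗ[K] L :=
  PiTensorProduct.lift
    ((MultilinearMap.mkPiAlgebra K (Fin r) L).compLinearMap
      fun i => (K⟮α i⟯.val : K⟮α i⟯ →ₐ[K] L).toLinearMap)

variable (K L) in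
/-- A finite extension `L / K` is modular if it is a tensor product over `K` of extensions
generated by one element. (For a finite extension all but finitely many tensor factors of such
a decomposition are equal to `K`, so finite families of factors suffice.) -/
def IsModularExtension : Prop :=
  ∃ (r : ℕ) (α : Fin r → L), Function.Bijective (adjoinTensorMul (K := K) α)

variable (K L) in
/-- A decomposition `L = K(α₀) ⊗ K(α₁) ⊗ ⋯ ⊗ K(αₘ)` over `K` with `α₀` separable over `K` and
`αᵢ` a `p ^ nᵢ`-th root of `aᵢ ∈ K`, of degree `p ^ nᵢ` over `K`, for `i = 1, …, m`. -/
structure ModularDecomposition (p : ℕ) where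
  /-- generator of the separable factor -/
  α₀ : L
  /-- number of purely inseparable factors -/
  m : ℕ
  /-- generators of the purely inseparable factors -/
  α : Fin m → L
  /-- exponents of the purely inseparable factors -/
  n : Fin m → ℕ
  /-- the elements of `K` whose roots are adjoined -/
  a : Fin m → K
  separable : IsSeparable K α₀
  minpoly_eq : ∀ i, minpoly K (α i) = X ^ p ^ n i - C (a i)
  bijective : Function.Bijective
    (LinearMap.mul' K L ∘ₗ
      TensorProduct.map (K⟮α₀⟯.val : K⟮α₀⟯ →ₐ[K] L).toLinearMap (adjoinTensorMul (K := K) α))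

end Modular

/-! ### The algebra of divided powers truncated at `N` -/

section DividedPower

variable (K : Type*) [Field K]

/-- Relations between the generators `D⁽ᵏ⁾`: `D⁽⁰⁾ = 1`, `D⁽ʰ⁾ D⁽ᵏ⁾ = (h+k choose h) D⁽ʰ⁺ᵏ⁾`, and
`D⁽ᵏ⁾ = 0` for `k ≥ N` (so that the product `D⁽ʰ⁾ D⁽ᵏ⁾` is zero for `h + k ≥ N`). -/
inductive TruncDividedPower.Rel (N : ℕ) : FreeAlgebra K ℕ → FreeAlgebra K ℕ → Prop
  | zero : Rel N (FreeAlgebra.ι K 0) 1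
  | mul (h k : ℕ) : Rel N (FreeAlgebra.ι K h * FreeAlgebra.ι K k)
      (((h + k).choose h : K) • FreeAlgebra.ι K (h + k))
  | trunc (k : ℕ) (hk : N ≤ k) : Rel N (FreeAlgebra.ι K k) 0

/-- The `K`-algebra on generators `D⁽ᵏ⁾`, `0 ≤ k < N`, with `D⁽⁰⁾ = 1` and
`D⁽ʰ⁾ D⁽ᵏ⁾ = (h+k choose h) D⁽ʰ⁺ᵏ⁾` if `h + k < N` and `0` otherwise. -/
abbrev TruncDividedPower (N : ℕ) : Type _ := RingQuot (TruncDividedPower.Rel K N)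

end DividedPower

section Derivation

variable {K E : Type*} [Field K] [Field E] [Algebra K E]

/-- For an extension `E` of `K` with basis `1, x, …, x ^ (N - 1)` the `K`-linear endomorphism
`x ^ l ↦ (l choose k) x ^ (l - k)`, `0 ≤ l < N`. -/
def PowerBasis.divDeriv (pb : PowerBasis K E) (k : ℕ) : Module.End K E :=
  pb.basis.constr K fun l => ((l : ℕ).choose k : K) • pb.gen ^ ((l : ℕ) - k)

lemma PowerBasis.divDeriv_gen_pow (pb : PowerBasis K E) (k : ℕ) {l : ℕ} (hl : l < pb.dim) :
    pb.divDeriv k (pb.gen ^ l) = (l.choose k : K) • pb.gen ^ (l - k) := by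
  have h := pb.basis.constr_basis K
    (fun l => ((l : ℕ).choose k : K) • pb.gen ^ ((l : ℕ) - k)) ⟨l, hl⟩
  rw [pb.coe_basis] at h
  exact h

lemma PowerBasis.divDeriv_ext (pb : PowerBasis K E) {f g : Module.End K E}
    (h : ∀ l < pb.dim, f (pb.gen ^ l) = g (pb.gen ^ l)) : f = g := by
  refine pb.basis.ext fun l => ?_
  rw [pb.coe_basis]
  exact h l l.2

/-- The action of the truncated divided power algebra on `E = K(x)`, where `D⁽ᵏ⁾` acts by
`x ^ l ↦ (l choose k) x ^ (l - k)`. -/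
def PowerBasis.divAction (pb : PowerBasis K E) {N : ℕ} (hN : pb.dim = N) :
    TruncDividedPower K N →ₐ[K] Module.End K E :=
  RingQuot.liftAlgHom K ⟨FreeAlgebra.lift K fun k => pb.divDeriv k, by
    intro x y hxy
    refine pb.divDeriv_ext fun l hl => ?_
    cases hxy with
    | zero => simp [pb.divDeriv_gen_pow 0 hl]
    | mul h k =>
      simp only [map_mul, map_smul, FreeAlgebra.lift_ι_apply, Module.End.mul_apply,
        LinearMap.smul_apply, pb.divDeriv_gen_pow _ hl,
        pb.divDeriv_gen_pow h (lt_of_le_of_lt (Nat.sub_le l k) hl), smul_smul]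
      rw [show l - k - h = l - (h + k) by omega]
      congr 1
      norm_cast
      rcases le_or_gt (h + k) l with hle | hlt
      · have := Nat.choose_mul (n := l) (k := h + k) (s := k) (Nat.le_add_left k h)
        rw [Nat.add_sub_cancel] at this
        rw [← this, mul_comm, Nat.choose_symm_add]
      · rw [Nat.choose_eq_zero_of_lt hlt, mul_zero]
        rcases le_or_gt k l with hk | hk
        · rw [Nat.choose_eq_zero_of_lt (show l - k < h by omega), mul_zero]
        · rw [Nat.choose_eq_zero_of_lt hk, zero_mul]
    | trunc k hk =>
      simp [pb.divDeriv_gen_pow _ hl, Nat.choose_eq_zero_of_lt (show l < k by omega)]⟩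

end Derivation

/-! ### The Galois-Hopf algebra -/

namespace ModularDecomposition

variable {K L : Type*} [Field K] [Field L] [Algebra K L] {p : ℕ}
variable (D : ModularDecomposition K L p)

/-- The factor `H₀ = K[G]`, with `G` the Galois group of `K(α₀)` over `K`. -/
abbrev H₀ : Type _ := MonoidAlgebra K (K⟮D.α₀⟯ ≃ₐ[K] K⟮D.α₀⟯)

/-- The factors `Hᵢ`, generated by `Dᵢ⁽ᵏ⁾`, `0 ≤ k < p ^ nᵢ`. -/
abbrev H (i : Fin D.m) : Type _ := TruncDividedPower K (p ^ D.n i)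

/-- The Galois-Hopf algebra `H₀ ⊗ H₁ ⊗ ⋯ ⊗ Hₘ` of `L / K`, as a `K`-algebra (neither the
comultiplication nor the counit matters for the question which subspaces are stable). -/
abbrev GHA : Type _ := D.H₀ ⊗[K] (⨂[K] i, D.H i)

/-- `g ∈ G` acts on `K(α₀)` as `g`. -/
def action₀ : D.H₀ →ₐ[K] Module.End K K⟮D.α₀⟯ :=
  MonoidAlgebra.lift K (Module.End K K⟮D.α₀⟯) (K⟮D.α₀⟯ ≃ₐ[K] K⟮D.α₀⟯)
    { toFun := fun g => g.toLinearMap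
      map_one' := rfl
      map_mul' := fun _ _ => rfl }

section

variable [FiniteDimensional K L]

/-- The power basis `1, αᵢ, …, αᵢ ^ (p ^ nᵢ - 1)` of `K(αᵢ)` over `K`. -/
def powerBasis (i : Fin D.m) : PowerBasis K K⟮D.α i⟯ :=
  adjoin.powerBasis (IsIntegral.of_finite K (D.α i))

lemma powerBasis_dim (i : Fin D.m) : (D.powerBasis i).dim = p ^ D.n i := by
  change (minpoly K (D.α i)).natDegree = _
  rw [D.minpoly_eq i, natDegree_X_pow_sub_C]

/-- `Hᵢ` acts on `K(αᵢ)` by `Dᵢ⁽ᵏ⁾(αᵢ ^ l) = (l choose k) αᵢ ^ (l - k)`. -/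
def actionFactor (i : Fin D.m) : D.H i →ₐ[K] Module.End K K⟮D.α i⟯ :=
  (D.powerBasis i).divAction (D.powerBasis_dim i)

/-- The action of `H₁ ⊗ ⋯ ⊗ Hₘ` on `K(α₁) ⊗ ⋯ ⊗ K(αₘ)`, factor by factor. -/
def actionPi : (⨂[K] i, D.H i) →ₐ[K] Module.End K (⨂[K] i, K⟮D.α i⟯) :=
  PiTensorProduct.liftAlgHom
    ((PiTensorProduct.mapMultilinear K (fun i => K⟮D.α i⟯) (fun i => K⟮D.α i⟯)).compLinearMap
      fun i => (D.actionFactor i).toLinearMap)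
    (by
      simp only [MultilinearMap.compLinearMap_apply, PiTensorProduct.mapMultilinear_apply,
        AlgHom.toLinearMap_apply, Pi.one_apply, map_one]
      exact PiTensorProduct.map_one)
    (fun x y => by
      simp only [MultilinearMap.compLinearMap_apply, PiTensorProduct.mapMultilinear_apply,
        AlgHom.toLinearMap_apply, Pi.mul_apply, map_mul]
      exact PiTensorProduct.map_mul _ _)

/-- The isomorphism `K(α₀) ⊗ K(α₁) ⊗ ⋯ ⊗ K(αₘ) ≃ L`. -/
def equiv : K⟮D.α₀⟯ ⊗[K] (⨂[K] i, K⟮D.α i⟯) ≃ₗ[K] L :=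
  LinearEquiv.ofBijective _ D.bijective

/-- The action of the Galois-Hopf algebra on `L = K(α₀) ⊗ K(α₁) ⊗ ⋯ ⊗ K(αₘ)`. -/
def action : D.GHA →ₐ[K] Module.End K L :=
  (D.equiv.conjAlgEquiv K).toAlgHom.comp
    ((Module.endTensorEndAlgHom (R := K) (S := K) (A := K)).comp
      (Algebra.TensorProduct.map D.action₀ D.actionPi))

/-- The natural action of the Galois-Hopf algebra on `L ⊗ V`: the action on `L` tensored with the
trivial action on `V`. -/
def actionOn (V : Type*) [AddCommGroup V] [Module K V] (d : D.GHA) :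
    L ⊗[K] V →ₗ[K] L ⊗[K] V :=
  (D.action d).rTensor V

/-- A subspace of `L ⊗ V` is stable under the Galois-Hopf algebra. -/
def IsGHAStable {V : Type*} [AddCommGroup V] [Module K V] (W : Submodule L (L ⊗[K] V)) : Prop :=
  ∀ d : D.GHA, ∀ w ∈ W, D.actionOn V d w ∈ W

end

end ModularDecomposition

/-! ### The Heerema-Galois group -/

/-- The truncated polynomial ring `R[X] / (X ^ N)`. -/
abbrev TruncPoly (R : Type*) [CommRing R] (N : ℕ) : Type _ := AdjoinRoot (X ^ N : R[X])

section HeeremaGalois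

variable (K L : Type*) [Field K] [Field L] [Algebra K L]

/-- The inclusion `K[X] / (X ^ N) → L[X] / (X ^ N)`. -/
def TruncPoly.map (N : ℕ) : TruncPoly K N →+* TruncPoly L N :=
  AdjoinRoot.map (algebraMap K L) (X ^ N) (X ^ N) (by simp)

/-- The Heerema-Galois group: the automorphisms of `L[X] / (X ^ N)` over `K[X] / (X ^ N)`, given
as those `K`-algebra automorphisms which fix every element of `K[X] / (X ^ N)`. -/
def HeeremaGaloisGroup (N : ℕ) : Subgroup (TruncPoly L N ≃ₐ[K] TruncPoly L N) where
  carrier := {φ | ∀ c : TruncPoly K N, φ (TruncPoly.map K L N c) = TruncPoly.map K L N c}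
  one_mem' _ := rfl
  mul_mem' {φ ψ} hφ hψ c := by
    rw [AlgEquiv.mul_apply, hψ c, hφ c]
  inv_mem' {φ} hφ c := by
    change φ.symm _ = _
    rw [AlgEquiv.symm_apply_eq, hφ c]

variable {K L}
variable {V : Type*} [AddCommGroup V] [Module K V]

/-- The submodule `W ⊗_L L[X]/(X ^ N)` of `L[X]/(X ^ N) ⊗_K V`, for `W` a subspace of `L ⊗_K V`,
through the identification of `L[X]/(X ^ N) ⊗_L (L ⊗_K V)` with `L[X]/(X ^ N) ⊗_K V`. -/
def truncExtend (N : ℕ) (W : Submodule L (L ⊗[K] V)) :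
    Submodule (TruncPoly L N) (TruncPoly L N ⊗[K] V) :=
  (W.baseChange (TruncPoly L N)).map
    (TensorProduct.AlgebraTensorModule.cancelBaseChange K L (TruncPoly L N) (TruncPoly L N)
      V).toLinearMap

/-- The submodule `W ⊗_L L[X]/(X ^ N)` of `L[X]/(X ^ N) ⊗_K V` is stable under the
Heerema-Galois group, which acts through the factor `L[X]/(X ^ N)`. -/
def IsHeeremaGaloisStable (N : ℕ) (W : Submodule L (L ⊗[K] V)) : Prop :=
  ∀ φ ∈ HeeremaGaloisGroup K L N, ∀ w ∈ truncExtend N W,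
    (φ.toLinearMap : TruncPoly L N →ₗ[K] TruncPoly L N).rTensor V w ∈ truncExtend N W

/-- A subspace `W` of `L ⊗ V` is defined over `K` if `W = L ⊗ W₀` for a subspace `W₀` of `V`. -/
def IsDefinedOver (W : Submodule L (L ⊗[K] V)) : Prop :=
  ∃ W₀ : Submodule K V, W = W₀.baseChange L

end HeeremaGalois

end

/-! The implications from (i) hold because both actions leave the factor `V` untouched. For the
converses, a single operator suffices. Let `f : L → K` be a nonzero functional such that `W` is
stable under `w ↦ 1 ⊗ f(w)`. The form `(x, y) ↦ f (x * y)` is nondegenerate, so `L / K` has a basis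
`b` with an `f`-dual family `c`, and `w = ∑ b i • (1 ⊗ f (c i • w))`. Thus `W` is spanned by vectors
`1 ⊗ v` (`isDefinedOver_of_functional_stable`).

The functional used is `D.integral`: the trace on `K(α₀)` tensored with the top coefficients on the
`K(αᵢ)`. In the Galois-Hopf algebra it is the action of `∑ g ⊗ D₁ ⊗ ⋯ ⊗ Dₘ`, with each `Dᵢ` the last
divided power. For the Heerema-Galois group, a coefficient of an automorphism restricted to `L`
preserves `W`: constant coefficients give the elements of `G`, and the shift `αᵢ ↦ αᵢ + X ^ p ^ (e -
nᵢ)` gives the `i`-th top coefficient. Composing and summing yields the same operator.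

Existence of a decomposition: let `S` be the separable closure of `K` in `L`, and `p ^ nᵢ` the
inseparable degree of the `i`-th given factor. By normality its generator is an `S`-combination of
`p ^ nᵢ`-th roots of elements of `K`. An exchange argument replaces each generator by one such root
while still generating `L / S`, and a degree count forces the tensor product to be direct. -/

noncomputable section

/-! ### Descent through one functional, and coefficients of automorphisms -/

section Descent

variable {K L : Type*} [Field K] [Field L] [Algebra K L] {V : Type*} [AddCommGroup V] [Module K V]

/-- A subspace of `L ⊗ V` stable under a nonzero functional `L → K ⊆ L` is defined over `K`. -/
theorem isDefinedOver_of_functional_stable [FiniteDimensional K L] (W : Submodule L (L ⊗[K] V))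
    (f : L →ₗ[K] K) (hf : f ≠ 0)
    (h : ∀ w ∈ W, (Algebra.linearMap K L ∘ₗ f).rTensor V w ∈ W) : IsDefinedOver W := by
  let b := Module.finBasis K L
  let B : L →ₗ[K] Module.Dual K L := (LinearMap.mul K L).compr₂ f
  have hB (x y : L) : B x y = f (x * y) := rfl
  have hinj : Function.Injective B := by
    rw [injective_iff_map_eq_zero]
    intro x hx
    by_contra hx0
    refine hf (LinearMap.ext fun y => ?_)
    have := LinearMap.congr_fun hx (x⁻¹ * y)
    rwa [hB, mul_inv_cancel_left₀ hx0] at this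
  have hsurj : Function.Surjective B :=
    (LinearMap.injective_iff_surjective_of_finrank_eq_finrank
      (Subspace.dual_finrank_eq (K := K) (V := L)).symm).1 hinj
  -- The dual family: `f (c i * x)` is the `i`-th coordinate of `x`.
  choose c hc using fun i => hsurj (b.coord i)
  let g : L ⊗[K] V →ₗ[K] V := (TensorProduct.lid K V).toLinearMap ∘ₗ f.rTensor V
  have hg (w : L ⊗[K] V) : (Algebra.linearMap K L ∘ₗ f).rTensor V w = 1 ⊗ₜ g w := by
    induction w with
    | zero => simp
    | add x y hx hy => rw [map_add, map_add, TensorProduct.tmul_add, hx, hy]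
    | tmul x v =>
      simp [g, TensorProduct.tmul_smul, TensorProduct.smul_tmul', Algebra.smul_def]
  refine ⟨(W.restrictScalars K).comap (TensorProduct.mk K L V 1), le_antisymm ?_ ?_⟩
  · intro w hw
    have key : w = ∑ i, b i • (1 : L) ⊗ₜ[K] g (c i • w) := by
      clear hw
      induction w with
      | zero => simp
      | add x y hx hy =>
        simp only [smul_add, map_add, TensorProduct.tmul_add, Finset.sum_add_distrib]
        rw [← hx, ← hy]
      | tmul x v =>
        have hi (i) : b i • (1 : L) ⊗ₜ[K] g (c i • x ⊗ₜ[K] v) = (b.repr x i • b i) ⊗ₜ[K] v := by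
          have h1 : f (c i * x) = b.repr x i := by
            rw [← hB, hc]; rfl
          simp [g, TensorProduct.smul_tmul', h1]
        simp_rw [hi]
        rw [← TensorProduct.sum_tmul, b.sum_repr]
    rw [key]
    refine Submodule.sum_mem _ fun i _ => Submodule.smul_mem _ _ ?_
    refine Submodule.tmul_mem_baseChange_of_mem _ ?_
    change (1 : L) ⊗ₜ[K] g (c i • w) ∈ W
    rw [← hg]
    exact h _ (W.smul_mem _ hw)
  · rw [Submodule.baseChange_eq_span, Submodule.span_le]
    rintro _ ⟨v, hv, rfl⟩
    exact hv

theorem rTensor_mem_baseChange {A : Type*} [CommRing A] [Algebra K A] {W₀ : Submodule K V}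
    (f : A →ₗ[K] A) {w : A ⊗[K] V} (hw : w ∈ W₀.baseChange A) :
    f.rTensor V w ∈ W₀.baseChange A := by
  obtain ⟨u, rfl⟩ := hw
  induction u with
  | zero => simp
  | add x y hx hy => rw [map_add, map_add]; exact add_mem hx hy
  | tmul x v => exact Submodule.tmul_mem_baseChange_of_mem _ v.2

variable {N : ℕ} {W : Submodule L (L ⊗[K] V)}

theorem truncExtend_eq_span : truncExtend N W = Submodule.span (TruncPoly L N)
    (((Algebra.linearMap L (TruncPoly L N)).restrictScalars K).rTensor V '' (W : Set (L ⊗[K] V))) := by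
  conv_lhs => rw [truncExtend, Submodule.baseChange_eq_span, Submodule.map_span]
  congr 1
  rw [Submodule.map_coe, Set.image_image]
  refine Set.image_congr fun w hw => ?_
  clear hw
  induction w with
  | zero => simp
  | add x y hx hy => rw [map_add, map_add, map_add, hx, hy]
  | tmul x v =>
    simp only [TensorProduct.mk_apply, LinearEquiv.coe_coe,
      TensorProduct.AlgebraTensorModule.cancelBaseChange_tmul, LinearMap.rTensor_tmul,
      LinearMap.restrictScalars_apply, Algebra.linearMap_apply, Algebra.algebraMap_eq_smul_one]

theorem truncExtend_baseChange (W₀ : Submodule K V) :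
    truncExtend N (W₀.baseChange L) = W₀.baseChange (TruncPoly L N) := by
  refine le_antisymm ?_ ?_
  · rw [truncExtend_eq_span, Submodule.span_le]
    rintro _ ⟨_, ⟨u, rfl⟩, rfl⟩
    induction u with
    | zero => simp
    | add x y hx hy => rw [map_add, map_add]; exact add_mem hx hy
    | tmul x v => exact Submodule.tmul_mem_baseChange_of_mem _ v.2
  · rw [Submodule.baseChange_eq_span, Submodule.span_le, truncExtend_eq_span]
    rintro _ ⟨v, hv, rfl⟩
    refine Submodule.subset_span ⟨1 ⊗ₜ v, Submodule.tmul_mem_baseChange_of_mem _ hv, ?_⟩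
    simp

theorem IsDefinedOver.isHeeremaGaloisStable (hW : IsDefinedOver W) :
    IsHeeremaGaloisStable N W := by
  obtain ⟨W₀, rfl⟩ := hW
  intro φ _ w hw
  rw [truncExtend_baseChange] at hw ⊢
  exact rTensor_mem_baseChange _ hw

/-- On a vector coming from `W`, the functional `c` acts as the scalar `c 1`. Precomposing `c` with
multiplication by `r` gives another `L`-linear functional, so the induction over the span must let
`c` vary. -/
theorem rTensor_mem_of_mem_truncExtend (c : TruncPoly L N →ₗ[L] L)
    {z : TruncPoly L N ⊗[K] V} (hz : z ∈ truncExtend N W) :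
    (c.restrictScalars K).rTensor V z ∈ W := by
  rw [truncExtend_eq_span] at hz
  induction hz using Submodule.span_induction generalizing c with
  | zero => simp
  | add x y _ _ hx hy => rw [map_add]; exact add_mem (hx c) (hy c)
  | mem x hx =>
    obtain ⟨w, hw, rfl⟩ := hx
    have : ∀ w : L ⊗[K] V, (c.restrictScalars K).rTensor V
        (((Algebra.linearMap L (TruncPoly L N)).restrictScalars K).rTensor V w) = c 1 • w := by
      clear hw w
      intro w
      induction w with
      | zero => simp
      | add x y hx hy => simp only [map_add, hx, hy, smul_add]
      | tmul x v =>
        simp only [LinearMap.rTensor_tmul, LinearMap.restrictScalars_apply,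
          Algebra.linearMap_apply, Algebra.algebraMap_eq_smul_one, map_smul,
          TensorProduct.smul_tmul', smul_eq_mul, mul_comm]
    rw [this]
    exact W.smul_mem _ hw
  | smul r x hx' hx =>
    have := hx (c ∘ₗ LinearMap.mulLeft L r)
    convert this using 1
    clear hx this hx'
    induction x with
    | zero => simp
    | add x y hx hy => simp only [map_add, hx, hy, smul_add]
    | tmul x v => simp [TensorProduct.smul_tmul']

/-- The coefficients of an automorphism in the Heerema-Galois group preserve `W`. -/
theorem IsHeeremaGaloisStable.coeff_mem (hW : IsHeeremaGaloisStable N W)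
    {φ : TruncPoly L N ≃ₐ[K] TruncPoly L N} (hφ : φ ∈ HeeremaGaloisGroup K L N)
    (c : TruncPoly L N →ₗ[L] L) {w : L ⊗[K] V} (hw : w ∈ W) :
    (c.restrictScalars K ∘ₗ φ.toLinearMap ∘ₗ
      (Algebra.linearMap L (TruncPoly L N)).restrictScalars K).rTensor V w ∈ W := by
  rw [LinearMap.rTensor_comp, LinearMap.rTensor_comp]
  refine rTensor_mem_of_mem_truncExtend c (hW φ hφ _ ?_)
  rw [truncExtend_eq_span]
  exact Submodule.subset_span ⟨w, hw, rfl⟩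

end Descent

/-! ### Algebra maps out of a tensor product of fields -/

section ProdAlgHom

variable {K : Type*} [Field K] {r : ℕ} {E₀ : Type*} [Field E₀] [Algebra K E₀]
  {E : Fin r → Type*} [∀ i, Field (E i)] [∀ i, Algebra K (E i)]
  {R : Type*} [CommRing R] [Algebra K R]

/-- The algebra homomorphism `x₁ ⊗ ⋯ ⊗ xᵣ ↦ ψ₁(x₁) ⋯ ψᵣ(xᵣ)`. -/
def PiTensorProduct.prodAlgHom (ψ : ∀ i, E i →ₐ[K] R) : (⨂[K] i, E i) →ₐ[K] R :=
  PiTensorProduct.liftAlgHom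
    ((MultilinearMap.mkPiAlgebra K (Fin r) R).compLinearMap fun i => (ψ i).toLinearMap)
    (by simp) (fun x y => by simp [Finset.prod_mul_distrib])

theorem PiTensorProduct.prodAlgHom_tprod (ψ : ∀ i, E i →ₐ[K] R) (y : ∀ i, E i) :
    PiTensorProduct.prodAlgHom ψ (PiTensorProduct.tprod K y) = ∏ i, ψ i (y i) :=
  (PiTensorProduct.lift.tprod _).trans (by simp)

/-- The linear map `x₀ ⊗ (x₁ ⊗ ⋯ ⊗ xᵣ) ↦ ψ₀(x₀) ψ₁(x₁) ⋯ ψᵣ(xᵣ)`. -/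
abbrev tensorMul (ψ₀ : E₀ →ₐ[K] R) (ψ : ∀ i, E i →ₐ[K] R) : E₀ ⊗[K] (⨂[K] i, E i) →ₗ[K] R :=
  LinearMap.mul' K R ∘ₗ TensorProduct.map ψ₀.toLinearMap (PiTensorProduct.lift
    ((MultilinearMap.mkPiAlgebra K (Fin r) R).compLinearMap fun i => (ψ i).toLinearMap))

/-- Bijectivity in a decomposition is stated for a linear map; this exhibits that map as an algebra
homomorphism, so that it has an algebra inverse and its range is a subalgebra. -/
theorem tensorMul_eq (ψ₀ : E₀ →ₐ[K] R) (ψ : ∀ i, E i →ₐ[K] R) : tensorMul ψ₀ ψ =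
    (Algebra.TensorProduct.productMap ψ₀ (PiTensorProduct.prodAlgHom ψ)).toLinearMap := by
  ext x y
  simp [PiTensorProduct.prodAlgHom_tprod]

variable {L : Type*} [Field L] [Algebra K L]

/-- Homomorphisms on the factors of a tensor product decomposition of `L` combine to a
homomorphism on `L`. -/
theorem exists_algHom_of_tensorMul_bijective {ι₀ : E₀ →ₐ[K] L} {ι : ∀ i, E i →ₐ[K] L}
    (h : Function.Bijective (tensorMul ι₀ ι)) (ψ₀ : E₀ →ₐ[K] R) (ψ : ∀ i, E i →ₐ[K] R) :
    ∃ Ψ : L →ₐ[K] R, (∀ x, Ψ (ι₀ x) = ψ₀ x) ∧ ∀ i x, Ψ (ι i x) = ψ i x := by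
  rw [tensorMul_eq] at h
  let e := AlgEquiv.ofBijective
    (Algebra.TensorProduct.productMap ι₀ (PiTensorProduct.prodAlgHom ι)) h
  have he (x : E₀) (y : ∀ i, E i) :
      e (x ⊗ₜ PiTensorProduct.tprod K y) = ι₀ x * ∏ i, ι i (y i) := by
    change Algebra.TensorProduct.productMap ι₀ (PiTensorProduct.prodAlgHom ι)
      (x ⊗ₜ PiTensorProduct.tprod K y) = _
    simp [PiTensorProduct.prodAlgHom_tprod]
  let Φ : L →ₐ[K] R := (Algebra.TensorProduct.productMap ψ₀
    (PiTensorProduct.prodAlgHom ψ)).comp e.symm.toAlgHom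
  have key (x : E₀) (y : ∀ i, E i) : Φ (ι₀ x * ∏ i, ι i (y i)) = ψ₀ x * ∏ i, ψ i (y i) := by
    rw [← he]
    simp [Φ, PiTensorProduct.prodAlgHom_tprod]
  refine ⟨Φ, fun x => ?_, fun i x => ?_⟩
  · simpa using key x 1
  -- The pure tensor with `x` in slot `i` and `1` elsewhere.
  · have h := key 1 (Pi.mulSingle i x)
    rw [Finset.prod_eq_single i, Finset.prod_eq_single i] at h
    · simpa using h
    all_goals simp +contextual

theorem tensorMul_surjective {ι₀ : E₀ →ₐ[K] L} {ι : ∀ i, E i →ₐ[K] L}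
    (h : ι₀.range ⊔ ⨆ i, (ι i).range = ⊤) : Function.Surjective (tensorMul ι₀ ι) := by
  rw [tensorMul_eq]
  refine (AlgHom.range_eq_top _).1 (eq_top_iff.2 (h.ge.trans (sup_le ?_ (iSup_le fun i => ?_))))
  · rintro _ ⟨x, rfl⟩
    exact ⟨x ⊗ₜ 1, by simp⟩
  · rintro _ ⟨x, rfl⟩
    refine ⟨1 ⊗ₜ PiTensorProduct.tprod K (Pi.mulSingle i x), ?_⟩
    simp only [AlgHom.toRingHom_eq_coe, RingHom.coe_coe,
      Algebra.TensorProduct.productMap_apply_tmul, map_one, PiTensorProduct.prodAlgHom_tprod,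
      one_mul]
    rw [Finset.prod_eq_single i]
    all_goals simp +contextual

end ProdAlgHom

/-! ### Endomorphisms of `L` acting factor by factor -/

namespace ModularDecomposition

variable {K L : Type*} [Field K] [Field L] [Algebra K L] {p : ℕ}
variable (D : ModularDecomposition K L p)

theorem equiv_tmul_tprod (x : K⟮D.α₀⟯) (y : ∀ i, K⟮D.α i⟯) :
    D.equiv (x ⊗ₜ PiTensorProduct.tprod K y) = x * ∏ i, (y i : L) := by
  simp [equiv, adjoinTensorMul]

theorem linearMap_ext {M : Type*} [AddCommGroup M] [Module K M] {f g : L →ₗ[K] M}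
    (h : ∀ (x : K⟮D.α₀⟯) (y : ∀ i, K⟮D.α i⟯), f (x * ∏ i, (y i : L)) = g (x * ∏ i, (y i : L))) :
    f = g := by
  have : f ∘ₗ D.equiv.toLinearMap = g ∘ₗ D.equiv.toLinearMap := by
    ext x y
    simpa [equiv_tmul_tprod] using h x y
  refine LinearMap.ext fun z => ?_
  obtain ⟨z, rfl⟩ := D.equiv.surjective z
  exact LinearMap.congr_fun this z

/-- Homomorphisms on the factors of `L` combine to a homomorphism on `L`. -/
theorem exists_algHom {R : Type*} [CommRing R] [Algebra K R] (ψ₀ : K⟮D.α₀⟯ →ₐ[K] R)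
    (ψ : ∀ i, K⟮D.α i⟯ →ₐ[K] R) : ∃ Ψ : L →ₐ[K] R,
      (∀ x : K⟮D.α₀⟯, Ψ x = ψ₀ x) ∧ ∀ i, ∀ x : K⟮D.α i⟯, Ψ x = ψ i x :=
  exists_algHom_of_tensorMul_bijective (ι₀ := K⟮D.α₀⟯.val) (ι := fun i => K⟮D.α i⟯.val)
    D.bijective ψ₀ ψ

theorem mem_of_factors_le {A : Subalgebra K L} (h₀ : ∀ x ∈ K⟮D.α₀⟯, x ∈ A)
    (h : ∀ i, ∀ x ∈ K⟮D.α i⟯, x ∈ A) (z : L) : z ∈ A := by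
  obtain ⟨z, rfl⟩ := D.equiv.surjective z
  induction z with
  | zero => rw [map_zero]; exact zero_mem _
  | add x y hx hy => rw [map_add]; exact add_mem hx hy
  | tmul x y =>
    induction y using PiTensorProduct.induction_on with
    | smul_tprod c y =>
      rw [TensorProduct.tmul_smul, map_smul, equiv_tmul_tprod]
      exact A.smul_mem (mul_mem (h₀ _ x.2) (prod_mem fun i _ => h i _ (y i).2)) _
    | add y z hy hz => rw [TensorProduct.tmul_add, map_add]; exact add_mem hy hz

/-- The endomorphism `g ⊗ f₁ ⊗ ⋯ ⊗ fₘ` of `L = K(α₀) ⊗ K(α₁) ⊗ ⋯ ⊗ K(αₘ)`. -/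
def mapEnd (g : Module.End K K⟮D.α₀⟯) (f : ∀ i, Module.End K K⟮D.α i⟯) : Module.End K L :=
  D.equiv.conj (TensorProduct.map g (PiTensorProduct.map f))

theorem mapEnd_apply (g : Module.End K K⟮D.α₀⟯) (f : ∀ i, Module.End K K⟮D.α i⟯)
    (x : K⟮D.α₀⟯) (y : ∀ i, K⟮D.α i⟯) :
    D.mapEnd g f (x * ∏ i, (y i : L)) = g x * ∏ i, (f i (y i) : L) := by
  rw [mapEnd, LinearEquiv.conj_apply_apply, ← equiv_tmul_tprod, LinearEquiv.symm_apply_apply,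
    TensorProduct.map_tmul, PiTensorProduct.map_tprod, equiv_tmul_tprod]

theorem mapEnd_mul (g g' : Module.End K K⟮D.α₀⟯) (f f' : ∀ i, Module.End K K⟮D.α i⟯) :
    D.mapEnd (g * g') (f * f') = D.mapEnd g f * D.mapEnd g' f' :=
  D.linearMap_ext fun x y => by
    simp only [Module.End.mul_apply, mapEnd_apply, Pi.mul_apply]

theorem mapEnd_one : D.mapEnd 1 1 = 1 :=
  D.linearMap_ext fun x y => by simp only [mapEnd_apply, Module.End.one_apply, Pi.one_apply]

theorem mapEnd_sum_left {ι : Type*} (s : Finset ι) (g : ι → Module.End K K⟮D.α₀⟯)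
    (f : ∀ i, Module.End K K⟮D.α i⟯) :
    D.mapEnd (∑ j ∈ s, g j) f = ∑ j ∈ s, D.mapEnd (g j) f :=
  D.linearMap_ext fun x y => by
    simp [mapEnd_apply, Finset.sum_mul, LinearMap.sum_apply]

section

variable [FiniteDimensional K L]

theorem action_tmul_tprod (a : D.H₀) (h : ∀ i, D.H i) :
    D.action (a ⊗ₜ PiTensorProduct.tprod K h) =
      D.mapEnd (D.action₀ a) fun i => D.actionFactor i (h i) :=
  D.linearMap_ext fun x y => by
    rw [mapEnd_apply, ← equiv_tmul_tprod, ← equiv_tmul_tprod]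
    simp only [action, actionPi, AlgHom.comp_apply, Algebra.TensorProduct.map_tmul]
    refine congrArg D.equiv ?_
    refine (congrArg _ (D.equiv.symm_apply_apply _)).trans ?_
    refine (LinearMap.congr_fun (Module.endTensorEndAlgHom_apply _ _) _).trans ?_
    refine congrArg (fun z => D.action₀ a x ⊗ₜ[K] z) ?_
    refine (LinearMap.congr_fun (PiTensorProduct.lift.tprod _) _).trans ?_
    exact PiTensorProduct.map_tprod _ _

end

end ModularDecomposition

/-! ### The last divided power is the top coefficient -/

section PowerBasis

variable {K E : Type*} [Field K] [Field E] [Algebra K E]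

/-- The coefficient of the highest power of the generator. -/
def PowerBasis.topCoord (pb : PowerBasis K E) : E →ₗ[K] K :=
  pb.basis.coord ⟨pb.dim - 1, Nat.sub_lt pb.dim_pos one_pos⟩

theorem PowerBasis.topCoord_gen_pow (pb : PowerBasis K E) {l : ℕ} (hl : l < pb.dim) :
    pb.topCoord (pb.gen ^ l) = if l = pb.dim - 1 then 1 else 0 := by
  have := pb.basis.repr_self ⟨l, hl⟩
  rw [pb.coe_basis] at this
  simp only at this
  rw [topCoord, Module.Basis.coord_apply, this, Finsupp.single_apply]
  simp

/-- For `l < N`, the binomial coefficient of `l` over `N - 1` vanishes unless `l = N - 1`. -/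
theorem PowerBasis.divDeriv_dim_sub_one (pb : PowerBasis K E) :
    pb.divDeriv (pb.dim - 1) = Algebra.linearMap K E ∘ₗ pb.topCoord := by
  refine pb.divDeriv_ext fun l hl => ?_
  rw [pb.divDeriv_gen_pow _ hl, LinearMap.comp_apply, pb.topCoord_gen_pow hl]
  split_ifs with h
  · subst h; simp
  · rw [Nat.choose_eq_zero_of_lt (by omega)]; simp

theorem PowerBasis.divAction_ι (pb : PowerBasis K E) {N : ℕ} (hN : pb.dim = N) (k : ℕ) :
    pb.divAction hN (RingQuot.mkAlgHom K _ (FreeAlgebra.ι K k)) = pb.divDeriv k := by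
  rw [divAction, RingQuot.liftAlgHom_mkAlgHom_apply, FreeAlgebra.lift_ι_apply]

end PowerBasis

/-! ### Descent from stability under the Galois-Hopf algebra -/

namespace ModularDecomposition

variable {K L : Type*} [Field K] [Field L] [Algebra K L] {p : ℕ}
variable (D : ModularDecomposition K L p) [FiniteDimensional K L]

/-- The trace of `K(α₀) / K`, as an endomorphism. -/
def traceEnd : Module.End K K⟮D.α₀⟯ := Algebra.linearMap K K⟮D.α₀⟯ ∘ₗ Algebra.trace K K⟮D.α₀⟯

/-- The top coefficient with respect to the powers of `αᵢ`, as an endomorphism. -/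
def topEnd (i : Fin D.m) : Module.End K K⟮D.α i⟯ :=
  Algebra.linearMap K K⟮D.α i⟯ ∘ₗ (D.powerBasis i).topCoord

/-- The tensor product of the trace of `K(α₀) / K` and the top coefficients. -/
def integral : L →ₗ[K] K :=
  (TensorProduct.lid K K).toLinearMap ∘ₗ TensorProduct.map (Algebra.trace K K⟮D.α₀⟯)
    (PiTensorProduct.lift ((MultilinearMap.mkPiAlgebra K (Fin D.m) K).compLinearMap
      fun i => (D.powerBasis i).topCoord)) ∘ₗ D.equiv.symm.toLinearMap

theorem integral_apply (x : K⟮D.α₀⟯) (y : ∀ i, K⟮D.α i⟯) :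
    D.integral (x * ∏ i, (y i : L)) =
      Algebra.trace K _ x * ∏ i, (D.powerBasis i).topCoord (y i) := by
  rw [← equiv_tmul_tprod]
  simp [integral]

theorem mapEnd_traceEnd_topEnd :
    D.mapEnd D.traceEnd D.topEnd = Algebra.linearMap K L ∘ₗ D.integral :=
  D.linearMap_ext fun x y => by
    rw [mapEnd_apply, LinearMap.comp_apply, integral_apply, Algebra.linearMap_apply, map_mul,
      map_prod]
    rfl

/-- The trace of a separable extension is surjective, and the highest power of each `αᵢ` has top
coefficient `1`. -/
theorem integral_ne_zero : D.integral ≠ 0 := by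
  have : Algebra.IsSeparable K K⟮D.α₀⟯ :=
    (isSeparable_adjoin_simple_iff_isSeparable K L).2 D.separable
  obtain ⟨x, hx⟩ := Algebra.trace_surjective K K⟮D.α₀⟯ 1
  intro h
  have := D.integral_apply x fun i => (D.powerBasis i).gen ^ ((D.powerBasis i).dim - 1)
  simp [h, hx, PowerBasis.topCoord_gen_pow, PowerBasis.dim_pos] at this

theorem isDefinedOver_of_mapEnd_stable {V : Type*} [AddCommGroup V] [Module K V]
    {W : Submodule L (L ⊗[K] V)}
    (h : ∀ w ∈ W, (D.mapEnd D.traceEnd D.topEnd).rTensor V w ∈ W) : IsDefinedOver W :=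
  isDefinedOver_of_functional_stable W D.integral D.integral_ne_zero
    (by rwa [← mapEnd_traceEnd_topEnd])

theorem traceEnd_eq_sum [IsGalois K K⟮D.α₀⟯] :
    D.traceEnd = ∑ g : K⟮D.α₀⟯ ≃ₐ[K] K⟮D.α₀⟯, g.toLinearMap := by
  ext x
  rw [traceEnd, LinearMap.comp_apply, Algebra.linearMap_apply, trace_eq_sum_automorphisms]
  simp

theorem IsGHAStable.isDefinedOver [IsGalois K K⟮D.α₀⟯] {V : Type*} [AddCommGroup V] [Module K V]
    {W : Submodule L (L ⊗[K] V)} (hW : D.IsGHAStable W) : IsDefinedOver W := by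
  refine D.isDefinedOver_of_mapEnd_stable fun w hw => ?_
  -- The group sum acts as the trace since `K(α₀) / K` is Galois; the last divided powers act as top
  -- coefficients.
  convert hW ((∑ g, MonoidAlgebra.of K _ g) ⊗ₜ PiTensorProduct.tprod K fun i =>
    RingQuot.mkAlgHom K _ (FreeAlgebra.ι K ((D.powerBasis i).dim - 1))) w hw using 1
  rw [actionOn, action_tmul_tprod]
  congr 3
  · rw [traceEnd_eq_sum, map_sum]
    refine Finset.sum_congr rfl fun g _ => ?_
    rw [action₀, MonoidAlgebra.lift_of]
    rfl
  · funext i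
    rw [actionFactor, PowerBasis.divAction_ι, PowerBasis.divDeriv_dim_sub_one]
    rfl

end ModularDecomposition

/-! ### Constructing Heerema-Galois automorphisms -/

section TruncPoly

variable {K L : Type*} [Field K] [Field L] [Algebra K L] {N : ℕ}

/-- The coefficient of `X ^ k`. -/
def TruncPoly.coeff (L : Type*) [Field L] (N k : ℕ) : TruncPoly L N →ₗ[L] L :=
  lcoeff L k ∘ₗ AdjoinRoot.modByMonicHom (monic_X_pow N)

theorem TruncPoly.coeff_mk (k : ℕ) {f : L[X]} (hf : f.natDegree < N) :
    TruncPoly.coeff L N k (AdjoinRoot.mk _ f) = f.coeff k := by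
  rw [TruncPoly.coeff, LinearMap.comp_apply, AdjoinRoot.modByMonicHom_mk,
    (modByMonic_eq_self_iff (monic_X_pow N)).2, lcoeff_apply]
  rw [degree_X_pow]
  exact (degree_le_natDegree).trans_lt (by exact_mod_cast hf)

/-- An algebra homomorphism from `L` to `L[X] / (X ^ N)` which is surjective together with `X`
extends to an element of the Heerema-Galois group. -/
theorem exists_mem_heeremaGaloisGroup [FiniteDimensional K L] (Ψ : L →ₐ[K] TruncPoly L N)
    (h : ∀ A : Subalgebra K (TruncPoly L N), (∀ x, Ψ x ∈ A) → AdjoinRoot.root _ ∈ A →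
      ∀ x, AdjoinRoot.of _ x ∈ A) :
    ∃ φ ∈ HeeremaGaloisGroup K L N, ∀ x, φ (AdjoinRoot.of _ x) = Ψ x := by
  have hroot : (AdjoinRoot.root (X ^ N : L[X])) ^ N = 0 := by
    simpa using AdjoinRoot.eval₂_root (X ^ N : L[X])
  let φ : TruncPoly L N →ₐ[K] TruncPoly L N :=
    AdjoinRoot.liftAlgHom (X ^ N : L[X]) Ψ (AdjoinRoot.root _) (by simpa using hroot)
  have hof (x : L) : φ (AdjoinRoot.of _ x) = Ψ x := AdjoinRoot.liftAlgHom_of ..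
  have hφroot : φ (AdjoinRoot.root _) = AdjoinRoot.root _ := AdjoinRoot.liftAlgHom_root ..
  have hrr : AdjoinRoot.root (X ^ N : L[X]) ∈ φ.range := ⟨_, hφroot⟩
  have hsurj : Function.Surjective φ := by
    intro z
    change z ∈ φ.range
    induction z using AdjoinRoot.induction_on with
    | ih f =>
      induction f using Polynomial.induction_on' with
      | add f g hf hg => rw [map_add]; exact add_mem hf hg
      | monomial n a =>
        rw [← C_mul_X_pow_eq_monomial, map_mul, map_pow, AdjoinRoot.mk_X, AdjoinRoot.mk_C]
        exact mul_mem (h φ.range (fun x => ⟨_, hof x⟩) hrr a) (pow_mem hrr n)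
  have : Module.Finite L (TruncPoly L N) := (monic_X_pow N).finite_adjoinRoot
  have : Module.Finite K (TruncPoly L N) := Module.Finite.trans L _
  -- `TruncPoly L N` is finite-dimensional over `K`, so surjectivity suffices.
  have hinj : Function.Injective φ :=
    (LinearMap.injective_iff_surjective (f := φ.toLinearMap)).2 hsurj
  refine ⟨AlgEquiv.ofBijective φ ⟨hinj, hsurj⟩, fun c => ?_, fun x => hof x⟩
  change φ (TruncPoly.map K L N c) = TruncPoly.map K L N c
  have : (φ : TruncPoly L N →+* TruncPoly L N).comp (TruncPoly.map K L N) =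
      TruncPoly.map K L N := by
    refine AdjoinRoot.ringHom_ext (RingHom.ext fun a => ?_) ?_
    · simp only [RingHom.comp_apply, TruncPoly.map, AdjoinRoot.map_of, RingHom.coe_coe]
      rw [hof]
      exact (Ψ.commutes a).trans (by rw [IsScalarTower.algebraMap_apply K L (TruncPoly L N)]; rfl)
    · simp only [RingHom.comp_apply, TruncPoly.map, AdjoinRoot.map_root, RingHom.coe_coe]
      exact hφroot
  exact RingHom.congr_fun this c

end TruncPoly

/-! ### The separable factor is Galois; bound on the exponents -/

namespace ModularDecomposition

variable {K L : Type*} [Field K] [Field L] [Algebra K L] {p : ℕ}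
variable (D : ModularDecomposition K L p)

theorem α_pow (i : Fin D.m) : D.α i ^ p ^ D.n i = algebraMap K L (D.a i) := by
  have := minpoly.aeval K (D.α i)
  rwa [D.minpoly_eq, map_sub, map_pow, aeval_X, aeval_C, sub_eq_zero] at this

variable [Fact p.Prime] [CharP K p]

theorem isPurelyInseparable : IsPurelyInseparable K⟮D.α₀⟯ L := by
  have : CharP K⟮D.α₀⟯ p := charP_of_injective_algebraMap (algebraMap K K⟮D.α₀⟯).injective p
  rw [isPurelyInseparable_iff_perfectClosure_eq_top, eq_top_iff]
  rintro z -
  refine D.mem_of_factors_le (A := ((perfectClosure K⟮D.α₀⟯ L).restrictScalars K).toSubalgebra)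
    (fun x hx => (perfectClosure K⟮D.α₀⟯ L).algebraMap_mem ⟨x, hx⟩) (fun i => ?_) z
  change K⟮D.α i⟯ ≤ (perfectClosure K⟮D.α₀⟯ L).restrictScalars K
  rw [adjoin_simple_le_iff]
  refine (mem_perfectClosure_iff_pow_mem p).2 ⟨D.n i, algebraMap K _ (D.a i), ?_⟩
  rw [α_pow, ← IsScalarTower.algebraMap_apply]

/-- Since `K(α₀) / K` is separable and `L / K(α₀)` purely inseparable, `K(α₀)` is the separable
closure of `K` in the normal extension `L`. -/
theorem isGalois [Normal K L] : IsGalois K K⟮D.α₀⟯ := by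
  have : Algebra.IsSeparable K K⟮D.α₀⟯ :=
    (isSeparable_adjoin_simple_iff_isSeparable K L).2 D.separable
  have := D.isPurelyInseparable
  rw [eq_separableClosure K L K⟮D.α₀⟯]
  infer_instance

/-- `αᵢ ^ p ^ e` is both separable and purely inseparable over `K`, hence in `K`, so `αᵢ` has degree
at most `p ^ e`. -/
theorem n_le {e : ℕ} (he : ∀ x : L, IsSeparable K (x ^ p ^ e)) (i : Fin D.m) : D.n i ≤ e := by
  have hα : D.α i ^ p ^ e ∈ separableClosure K L ⊓ perfectClosure K L :=
    ⟨he _, pow_mem ((mem_perfectClosure_iff_pow_mem p).2 ⟨D.n i, D.a i, (D.α_pow i).symm⟩) _⟩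
  rw [separableClosure_inf_perfectClosure, mem_bot] at hα
  obtain ⟨b, hb⟩ := hα
  have hp := Fact.out (p := p.Prime)
  have hdvd : minpoly K (D.α i) ∣ X ^ p ^ e - C b := minpoly.dvd _ _ (by simp [hb])
  have := natDegree_le_of_dvd hdvd (X_pow_sub_C_ne_zero (pow_pos hp.pos _) _)
  rw [D.minpoly_eq, natDegree_X_pow_sub_C, natDegree_X_pow_sub_C] at this
  exact (Nat.pow_le_pow_iff_right hp.one_lt).1 this

end ModularDecomposition

/-! ### Descent from stability under the Heerema-Galois group -/

namespace ModularDecomposition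

variable {K L : Type*} [Field K] [Field L] [Algebra K L] {p : ℕ}
variable (D : ModularDecomposition K L p) [FiniteDimensional K L]
variable {V : Type*} [AddCommGroup V] [Module K V] {W : Submodule L (L ⊗[K] V)}

/-- The inclusion of a subextension into `L[X] / (X ^ N)`. -/
abbrev ofFactor (N : ℕ) (F : IntermediateField K L) : F →ₐ[K] TruncPoly L N :=
  (AdjoinRoot.ofAlgHom K (X ^ N)).comp F.val

/-- Extend `g` by the identity on the other factors and on `X`, and take the constant coefficient.
-/
theorem mapEnd_galois_mem {N : ℕ} (hN : 0 < N) (hW : IsHeeremaGaloisStable N W)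
    (g : K⟮D.α₀⟯ ≃ₐ[K] K⟮D.α₀⟯) {w : L ⊗[K] V} (hw : w ∈ W) :
    (D.mapEnd g.toLinearMap 1).rTensor V w ∈ W := by
  obtain ⟨Ψ, hΨ₀, hΨ⟩ := D.exists_algHom ((ofFactor N K⟮D.α₀⟯).comp g.toAlgHom)
    fun i => ofFactor N K⟮D.α i⟯
  obtain ⟨φ, hφ, hφΨ⟩ := exists_mem_heeremaGaloisGroup Ψ fun A hA _ =>
    D.mem_of_factors_le (A := A.comap (AdjoinRoot.ofAlgHom K (X ^ N)))
      (fun x hx => by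
        have := hA (g.symm ⟨x, hx⟩ : K⟮D.α₀⟯)
        rw [hΨ₀] at this
        simpa using this)
      (fun i x hx => by
        have := hA (⟨x, hx⟩ : K⟮D.α i⟯)
        rw [hΨ] at this
        simpa using this)
  convert hW.coeff_mem hφ (TruncPoly.coeff L N 0) hw using 2
  refine congrArg _ (D.linearMap_ext fun x y => ?_)
  rw [mapEnd_apply]
  change _ = TruncPoly.coeff L N 0 (φ (AdjoinRoot.of _ (x * ∏ i, (y i : L))))
  rw [hφΨ, map_mul, map_prod, hΨ₀]
  simp_rw [hΨ]
  have : (ofFactor N K⟮D.α₀⟯).comp g.toAlgHom x * ∏ i, ofFactor N K⟮D.α i⟯ (y i) =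
      AdjoinRoot.mk (X ^ N) (C (g x * ∏ i, (y i : L))) := by
    rw [AdjoinRoot.mk_C, map_mul, map_prod]
    rfl
  rw [this, TruncPoly.coeff_mk _ (by rwa [natDegree_C]), coeff_C_zero]
  rfl

theorem powerBasis_gen (i : Fin D.m) : ((D.powerBasis i).gen : L) = D.α i := by
  simp [powerBasis]

variable [Fact p.Prime] [CharP K p]

/-- The exponent of `X` is chosen so that the `p ^ nᵢ`-th power of the shifted generator is `X ^ p ^
e + aᵢ = aᵢ`. -/
theorem exists_shift {e : ℕ} {i : Fin D.m} (hi : D.n i ≤ e) :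
    ∃ ψ : K⟮D.α i⟯ →ₐ[K] TruncPoly L (p ^ e),
      ψ (D.powerBasis i).gen = AdjoinRoot.mk _ (X ^ p ^ (e - D.n i) + C (D.α i)) := by
  have : CharP L p := charP_of_injective_algebraMap (algebraMap K L).injective p
  refine ⟨(D.powerBasis i).lift _ ?_, PowerBasis.lift_gen _ _ _⟩
  rw [← minpoly.algebraMap_eq (algebraMap K⟮D.α i⟯ L).injective]
  change aeval _ (minpoly K ((D.powerBasis i).gen : L)) = 0
  rw [powerBasis_gen, D.minpoly_eq, map_sub, map_pow, aeval_X, aeval_C, ← map_pow,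
    add_pow_char_pow, ← pow_mul, ← pow_add, Nat.sub_add_cancel hi, map_add, AdjoinRoot.mk_self,
    zero_add, ← C_pow, D.α_pow, AdjoinRoot.mk_C, sub_eq_zero,
    IsScalarTower.algebraMap_apply K L (TruncPoly L (p ^ e))]
  rfl

omit [CharP K p] in
-- With `q = p ^ (e - nᵢ)`, the image of `αᵢ ^ l` is monic of degree `q * l < p ^ e`. It reaches
-- degree `q * (p ^ nᵢ - 1)` only for the last basis power.
theorem coeff_shift {e : ℕ} {i : Fin D.m} (hi : D.n i ≤ e)
    (ψ : K⟮D.α i⟯ →ₐ[K] TruncPoly L (p ^ e))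
    (hψ : ψ (D.powerBasis i).gen = AdjoinRoot.mk _ (X ^ p ^ (e - D.n i) + C (D.α i)))
    (y : K⟮D.α i⟯) :
    TruncPoly.coeff L (p ^ e) (p ^ (e - D.n i) * (p ^ D.n i - 1)) (ψ y) = D.topEnd i y := by
  have hp := (Fact.out : p.Prime).pos
  suffices h : (TruncPoly.coeff L (p ^ e)
      (p ^ (e - D.n i) * (p ^ D.n i - 1))).restrictScalars K ∘ₗ ψ.toLinearMap =
      (Algebra.linearMap K L) ∘ₗ (D.powerBasis i).topCoord from LinearMap.congr_fun h y
  refine (D.powerBasis i).basis.ext fun l => ?_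
  obtain ⟨l, hl⟩ := l
  rw [PowerBasis.coe_basis]
  change TruncPoly.coeff L _ _ (ψ ((D.powerBasis i).gen ^ l)) =
    algebraMap K L ((D.powerBasis i).topCoord ((D.powerBasis i).gen ^ l))
  rw [PowerBasis.topCoord_gen_pow _ hl]
  rw [powerBasis_dim] at hl ⊢
  have hq : 0 < p ^ (e - D.n i) := pow_pos hp _
  have hdeg : ((X ^ p ^ (e - D.n i) + C (D.α i)) ^ l : L[X]).natDegree = p ^ (e - D.n i) * l := by
    rw [natDegree_pow, natDegree_X_pow_add_C, mul_comm]
  have hN : p ^ e = p ^ (e - D.n i) * p ^ D.n i := by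
    rw [← pow_add, Nat.sub_add_cancel hi]
  rw [map_pow, hψ, ← map_pow, TruncPoly.coeff_mk _ (by
    rw [hdeg, hN]; exact Nat.mul_lt_mul_of_pos_left hl hq)]
  split_ifs with h
  · rw [← h, ← hdeg, map_one]
    exact ((monic_X_pow_add_C _ hq.ne').pow l).coeff_natDegree
  · rw [map_zero]
    refine coeff_eq_zero_of_natDegree_lt ?_
    rw [hdeg]
    exact Nat.mul_lt_mul_of_pos_left (by omega) hq

theorem mapEnd_mulSingle_topEnd_mem {e : ℕ} (hW : IsHeeremaGaloisStable (p ^ e) W)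
    {i : Fin D.m} (hi : D.n i ≤ e) {w : L ⊗[K] V} (hw : w ∈ W) :
    (D.mapEnd 1 (Pi.mulSingle i (D.topEnd i))).rTensor V w ∈ W := by
  obtain ⟨ψ, hψ⟩ := D.exists_shift hi
  obtain ⟨Ψ, hΨ₀, hΨ⟩ := D.exists_algHom (ofFactor (p ^ e) K⟮D.α₀⟯)
    (Function.update (fun j => ofFactor (p ^ e) K⟮D.α j⟯) i ψ)
  have hΨi (y : K⟮D.α i⟯) : Ψ y = ψ y := by
    rw [hΨ, Function.update_self]
  have hΨj {j} (hj : j ≠ i) (y : K⟮D.α j⟯) : Ψ y = AdjoinRoot.of _ (y : L) := by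
    rw [hΨ, Function.update_of_ne hj]
    rfl
  obtain ⟨φ, hφ, hφΨ⟩ := exists_mem_heeremaGaloisGroup Ψ fun A hA hroot =>
    D.mem_of_factors_le (A := A.comap (AdjoinRoot.ofAlgHom K (X ^ p ^ e)))
      (fun x hx => by
        have := hA (⟨x, hx⟩ : K⟮D.α₀⟯)
        rw [hΨ₀] at this
        simpa using this)
      (fun j => by
        by_cases hj : j = i
        · subst hj
          change K⟮D.α j⟯.toSubalgebra ≤ _
          rw [adjoin_simple_toSubalgebra_of_isAlgebraic (Algebra.IsAlgebraic.isAlgebraic _),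
            Algebra.adjoin_le_iff, Set.singleton_subset_iff]
          -- `αⱼ` is recovered as its image minus a power of `X`.
          have := hA ((D.powerBasis j).gen : L)
          rw [hΨi, hψ, map_add, map_pow, AdjoinRoot.mk_X, AdjoinRoot.mk_C] at this
          simpa using sub_mem this (pow_mem hroot (p ^ (e - D.n j)))
        · intro x hx
          have := hA (⟨x, hx⟩ : K⟮D.α j⟯)
          rwa [hΨj hj] at this)
  convert hW.coeff_mem hφ (TruncPoly.coeff L (p ^ e) (p ^ (e - D.n i) * (p ^ D.n i - 1))) hw
    using 2
  refine congrArg _ (D.linearMap_ext fun x y => ?_)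
  rw [mapEnd_apply]
  change _ = TruncPoly.coeff L _ _ (φ (AdjoinRoot.of _ (x * ∏ i, (y i : L))))
  have h₁ : Ψ (x * ∏ j, (y j : L)) =
      ((x : L) * ∏ j ∈ Finset.univ.erase i, (y j : L)) • ψ (y i) := by
    rw [← Finset.mul_prod_erase _ _ (Finset.mem_univ i), map_mul, map_mul, hΨ₀, hΨi, map_prod,
      Finset.prod_congr rfl fun j hj => hΨj (Finset.ne_of_mem_erase hj) (y j), Algebra.smul_def,
      map_mul, map_prod]
    change AdjoinRoot.of _ (x : L) * _ = AdjoinRoot.of _ (x : L) * _ * _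
    rw [mul_assoc]
    congr 1
    exact mul_comm _ _
  rw [hφΨ, h₁, map_smul, D.coeff_shift hi ψ hψ, ← Finset.mul_prod_erase _ _ (Finset.mem_univ i),
    Pi.mulSingle_eq_same, Finset.prod_congr rfl fun j hj => by
      rw [Pi.mulSingle_eq_of_ne (Finset.ne_of_mem_erase hj)]]
  simp only [Module.End.one_apply, smul_eq_mul]
  ring

theorem isDefinedOver_of_isHeeremaGaloisStable (D : ModularDecomposition K L p) [Normal K L] {e : ℕ}
    (he : ∀ x : L, IsSeparable K (x ^ p ^ e)) (hW : IsHeeremaGaloisStable (p ^ e) W) :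
    IsDefinedOver W := by
  have := D.isGalois
  refine D.isDefinedOver_of_mapEnd_stable fun w hw => ?_
  -- Operators preserving `W` compose, so the top coefficients may be treated one factor at a time.
  let S : Submonoid (∀ i, Module.End K K⟮D.α i⟯) :=
    { carrier := {f | ∀ w ∈ W, (D.mapEnd 1 f).rTensor V w ∈ W}
      one_mem' := fun w hw => by
        rw [mapEnd_one]
        simpa [Module.End.one_eq_id] using hw
      mul_mem' := fun {f f'} hf hf' w hw => by
        have := D.mapEnd_mul 1 1 f f'
        rw [one_mul] at this
        rw [this, Module.End.mul_eq_comp, LinearMap.rTensor_comp]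
        exact hf _ (hf' w hw) }
  have htop : D.topEnd ∈ S := Submonoid.pi_mem_of_mulSingle_mem _ fun i w hw =>
    D.mapEnd_mulSingle_topEnd_mem hW (D.n_le he i) hw
  have hmul := D.mapEnd_mul D.traceEnd 1 1 D.topEnd
  rw [mul_one, one_mul, traceEnd_eq_sum, mapEnd_sum_left _ _ _ 1] at hmul
  rw [traceEnd_eq_sum, hmul, Module.End.mul_eq_comp, LinearMap.rTensor_comp,
    LinearMap.comp_apply, ← LinearMap.coe_rTensorHom, map_sum, LinearMap.sum_apply]
  exact sum_mem fun g _ => D.mapEnd_galois_mem (pow_pos (Fact.out : p.Prime).pos e) hW g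
    (htop w hw)

/-- Descent by the Galois-Hopf algebra and by the Heerema-Galois group. -/
theorem tfae_isDefinedOver [Normal K L] {e : ℕ} (he : ∀ x : L, IsSeparable K (x ^ p ^ e))
    (W : Submodule L (L ⊗[K] V)) :
    List.TFAE [IsDefinedOver W, D.IsGHAStable W, IsHeeremaGaloisStable (p ^ e) W] := by
  have := D.isGalois
  tfae_have 1 → 2 := by
    rintro ⟨W₀, rfl⟩ d w hw
    exact rTensor_mem_baseChange _ hw
  tfae_have 2 → 1 := IsGHAStable.isDefinedOver D
  tfae_have 1 → 3 := IsDefinedOver.isHeeremaGaloisStable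
  tfae_have 3 → 1 := D.isDefinedOver_of_isHeeremaGaloisStable he
  tfae_finish

end ModularDecomposition

/-! ### Generators of purely inseparable extensions -/

section PurelyInseparable

theorem IsPurelyInseparable.pow_finrank_mem (q : ℕ) {F E : Type*} [Field F] [Field E] [Algebra F E]
    [ExpChar F q] [IsPurelyInseparable F E] [FiniteDimensional F E] (x : E) :
    x ^ Module.finrank F E ∈ (algebraMap F E).range := by
  obtain ⟨n, y, h⟩ := IsPurelyInseparable.minpoly_eq_X_pow_sub_C F q x
  have hd : (minpoly F x).natDegree ∣ Module.finrank F E := minpoly.degree_dvd (.of_finite F x)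
  rw [h, natDegree_X_pow_sub_C] at hd
  obtain ⟨k, hk⟩ := hd
  have hx : x ^ q ^ n = algebraMap F E y := by
    have := minpoly.aeval F x
    rwa [h, map_sub, map_pow, aeval_X, aeval_C, sub_eq_zero] at this
  exact ⟨y ^ k, by rw [hk, pow_mul, hx, map_pow]⟩

variable {F E : Type*} [Field F] [Field E] [Algebra F E]

/-- Raising to the inseparable degree makes every element separable. -/
theorem pow_finInsepDegree_isSeparable (q : ℕ) [ExpChar F q] [FiniteDimensional F E] (x : E) :
    IsSeparable F (x ^ Field.finInsepDegree F E) := by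
  have : ExpChar (separableClosure F E) q :=
    expChar_of_injective_algebraMap (algebraMap F (separableClosure F E)).injective q
  obtain ⟨y, hy⟩ := IsPurelyInseparable.pow_finrank_mem q (F := separableClosure F E) x
  rw [Field.finInsepDegree, ← hy]
  exact mem_separableClosure_iff.1 y.2

/-- A finite purely inseparable extension generated by `T` and `p`-th powers is generated
by `T`. -/
theorem IsPurelyInseparable.adjoin_eq_top_of_adjoin_union_pow (q : ℕ) [ExpChar F q]
    [FiniteDimensional F E] [IsPurelyInseparable F E] {T : Set E}
    (h : adjoin F (T ∪ Set.range fun x : E => x ^ q) = ⊤) : adjoin F T = ⊤ := by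
  have : ExpChar E q := expChar_of_injective_algebraMap (algebraMap F E).injective q
  -- Applying Frobenius to the generation statement raises the exponent `k`; once `q ^ k = [E : F]`,
  -- the powers lie in `F` and are superfluous.
  have key (k : ℕ) : adjoin F (T ∪ Set.range fun x : E => x ^ q ^ k) = ⊤ := by
    induction k with
    | zero =>
      rw [eq_top_iff]
      exact fun x _ => subset_adjoin _ _ (Or.inr ⟨x, by simp⟩)
    | succ k ih =>
      rw [eq_top_iff, ← h, adjoin_le_iff]
      rintro _ (hx | ⟨x, rfl⟩)
      · exact subset_adjoin _ _ (Or.inl hx)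
      · change x ^ q ∈ _
        have hx : x ∈ adjoin F (T ∪ Set.range fun x : E => x ^ q ^ k) := ih ▸ mem_top
        induction hx using adjoin_induction with
        | mem x hx =>
          obtain hx | ⟨y, rfl⟩ := hx
          · have hx' : x ∈ adjoin F (T ∪ Set.range fun x : E => x ^ q ^ (k + 1)) :=
              subset_adjoin _ _ (Or.inl hx)
            exact _root_.pow_mem hx' q
          · exact subset_adjoin _ _ (Or.inr ⟨y, by simp [← pow_mul, pow_succ]⟩)
        | algebraMap a => exact _root_.pow_mem (IntermediateField.algebraMap_mem _ a) _
        | add x y _ _ hx hy => rw [add_pow_expChar]; exact add_mem hx hy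
        | inv x _ hx => rw [inv_pow]; exact inv_mem hx
        | mul x y _ _ hx hy => rw [mul_pow]; exact mul_mem hx hy
  obtain ⟨n, hn⟩ := IsPurelyInseparable.finrank_eq_pow (F := F) (E := E) q
  rw [eq_top_iff, ← key n, adjoin_le_iff]
  rintro _ (hx | ⟨x, rfl⟩)
  · exact subset_adjoin _ _ hx
  · obtain ⟨y, hy⟩ := IsPurelyInseparable.pow_finrank_mem q (F := F) x
    rw [hn] at hy
    change x ^ q ^ n ∈ _
    rw [← hy]
    exact IntermediateField.algebraMap_mem _ _

/-- Exchange: a generator which is a linear combination of elements of `Y` can be replaced by an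
element of `Y`. -/
theorem IsPurelyInseparable.exists_adjoin_insert_eq_top (p : ℕ) [Fact p.Prime] [CharP F p]
    [FiniteDimensional F E] [IsPurelyInseparable F E] {T Y : Set E} {x : E}
    (h : adjoin F (insert x T) = ⊤) (hY : Y.Nonempty) (hx : x ∈ Submodule.span F Y) :
    ∃ y ∈ Y, adjoin F (insert y T) = ⊤ := by
  have hE : ExpChar F p := inferInstance
  -- `M` contains all `p`-th powers and `E = M(x)`, so `[E : M] ≤ p`. If `Y ⊆ M`, then `x ∈ M` and
  -- `T` alone generates; otherwise any `y ∈ Y` outside `M` has degree a nontrivial power of `p`, so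
  -- `M(y) = E`.
  set M := adjoin F (T ∪ Set.range fun x : E => x ^ p) with hM
  by_cases hYM : Y ⊆ M
  · obtain ⟨y, hy⟩ := hY
    refine ⟨y, hy, ?_⟩
    have hxM : x ∈ M := by
      have : Submodule.span F Y ≤ Subalgebra.toSubmodule M.toSubalgebra := Submodule.span_le.2 hYM
      exact this hx
    have hT : adjoin F T = ⊤ := by
      refine IsPurelyInseparable.adjoin_eq_top_of_adjoin_union_pow p (eq_top_iff.2 ?_)
      rw [← h, adjoin_le_iff]
      exact Set.insert_subset hxM fun t ht => subset_adjoin _ _ (Or.inl ht)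
    rw [eq_top_iff, ← hT]
    exact adjoin.mono _ _ _ (Set.subset_insert _ _)
  · obtain ⟨y, hy, hyM⟩ := Set.not_subset.1 hYM
    refine ⟨y, hy, IsPurelyInseparable.adjoin_eq_top_of_adjoin_union_pow p ?_⟩
    have : CharP M p := charP_of_injective_algebraMap (algebraMap F M).injective p
    have hpow (z : E) : z ^ p ∈ M := subset_adjoin _ _ (Or.inr ⟨z, rfl⟩)
    have hxtop : M⟮x⟯ = ⊤ := by
      rw [← restrictScalars_eq_top_iff (K := F), eq_top_iff, ← h, adjoin_le_iff]
      refine Set.insert_subset (mem_adjoin_simple_self M x) fun t ht => ?_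
      exact M⟮x⟯.algebraMap_mem ⟨t, subset_adjoin _ _ (Or.inl ht)⟩
    have hle : Module.finrank M E ≤ p := by
      rw [← finrank_top', ← hxtop, adjoin.finrank (.of_finite M x)]
      have hdvd : minpoly M x ∣ X ^ p - C ⟨x ^ p, hpow x⟩ := minpoly.dvd _ _ (by
        simp)
      have := natDegree_le_of_dvd hdvd (X_pow_sub_C_ne_zero (Fact.out : p.Prime).pos _)
      rwa [natDegree_X_pow_sub_C] at this
    have hytop : M⟮y⟯ = ⊤ := by
      obtain ⟨n, hn⟩ := IsPurelyInseparable.finrank_eq_pow (F := M) (E := M⟮y⟯) p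
      have hn0 : n ≠ 0 := by
        rintro rfl
        rw [pow_zero, IntermediateField.finrank_eq_one_iff] at hn
        have hy' := mem_adjoin_simple_self M y
        rw [hn, mem_bot] at hy'
        obtain ⟨z, rfl⟩ := hy'
        exact hyM z.2
      refine eq_of_le_of_finrank_le le_top ?_
      rw [finrank_top', hn]
      exact hle.trans (Nat.le_self_pow hn0 p)
    rw [← restrictScalars_eq_top_iff (K := F), eq_top_iff] at hytop
    rw [eq_top_iff]
    refine hytop.trans ?_
    let M' : IntermediateField F E := adjoin F (insert y T ∪ Set.range fun x : E => x ^ p)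
    have hMM : M ≤ M' := adjoin.mono _ _ _ (Set.union_subset_union_left _ (Set.subset_insert _ _))
    change (M⟮y⟯).restrictScalars F ≤ M'
    rw [restrictScalars_adjoin_eq_sup, sup_le_iff]
    exact ⟨hMM, adjoin_simple_le_iff.2 (subset_adjoin _ _ (Or.inl (Set.mem_insert _ _)))⟩

/-- Generators of a purely inseparable extension can be chosen in given sets whose spans contain
given generators. -/
theorem IsPurelyInseparable.exists_adjoin_range_eq_top (p : ℕ) [Fact p.Prime] [CharP F p]
    [FiniteDimensional F E] [IsPurelyInseparable F E] {ι : Type*} [Fintype ι] {x : ι → E}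
    {Y : ι → Set E} (h : adjoin F (Set.range x) = ⊤) (hY : ∀ i, (Y i).Nonempty)
    (hx : ∀ i, x i ∈ Submodule.span F (Y i)) :
    ∃ y : ι → E, (∀ i, y i ∈ Y i) ∧ adjoin F (Set.range y) = ⊤ := by
  classical
  -- Generators are exchanged one at a time; those outside `s` are still the original ones.
  have key (s : Finset ι) : ∃ y : ι → E, (∀ i ∈ s, y i ∈ Y i) ∧ (∀ i ∉ s, y i = x i) ∧
      adjoin F (Set.range y) = ⊤ := by
    induction s using Finset.induction_on with
    | empty => exact ⟨x, by simp, by simp, h⟩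
    | insert i s hi ih =>
      obtain ⟨y, hys, hyx, hy⟩ := ih
      have hr (z : E) : Set.range (Function.update y i z) = insert z (y '' {i}ᶜ) := by
        ext t
        constructor
        · rintro ⟨j, rfl⟩
          by_cases hj : j = i
          · subst hj; simp
          · rw [Function.update_of_ne hj]
            exact Or.inr ⟨j, hj, rfl⟩
        · rintro (rfl | ⟨j, hj, rfl⟩)
          · exact ⟨i, by simp⟩
          · exact ⟨j, Function.update_of_ne hj _ _⟩
      rw [← Function.update_eq_self i y, hr, hyx i hi] at hy
      obtain ⟨z, hz, htop⟩ := IsPurelyInseparable.exists_adjoin_insert_eq_top p hy (hY i) (hx i)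
      refine ⟨Function.update y i z, fun j hj => ?_, fun j hj => ?_, by rw [hr, htop]⟩
      · by_cases hji : j = i
        · subst hji; simpa using hz
        · rw [Function.update_of_ne hji]
          exact hys j (Finset.mem_of_mem_insert_of_ne hj hji)
      · rw [Finset.mem_insert, not_or] at hj
        rw [Function.update_of_ne hj.1, hyx j hj.2]
  obtain ⟨y, hy, -, htop⟩ := key Finset.univ
  exact ⟨y, fun i => hy i (Finset.mem_univ i), htop⟩

end PurelyInseparable

/-! ### Splitting a normal extension into separable and purely inseparable parts -/

section Normal

variable {K L : Type*} [Field K] [Field L] [Algebra K L]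

/-- A finite normal extension is separable over its maximal purely inseparable subextension. -/
theorem isSeparable_perfectClosure_of_normal [FiniteDimensional K L] [Normal K L] :
    Algebra.IsSeparable (perfectClosure K L) L := by
  classical
  -- By normality, automorphisms act transitively on the roots of a minimal polynomial, so a fixed
  -- element is its only root.
  have hle : fixedField (⊤ : Subgroup (L ≃ₐ[K] L)) ≤ perfectClosure K L := by
    intro x hx
    rw [mem_perfectClosure_iff_natSepDegree_eq_one,
      natSepDegree_eq_of_splits (E := L) _ (Normal.splits inferInstance x), Finset.card_eq_one]
    have hint : IsIntegral K x := .of_finite K x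
    refine ⟨x, Finset.ext fun y => ?_⟩
    rw [Multiset.mem_toFinset, mem_aroots, Finset.mem_singleton]
    constructor
    · rintro ⟨-, hy⟩
      obtain ⟨σ, rfl⟩ := minpoly.exists_algEquiv_of_root' hint.isAlgebraic hy
      exact hx ⟨σ, trivial⟩
    · rintro rfl
      exact ⟨minpoly.ne_zero hint, minpoly.aeval K y⟩
  let _ := (inclusion hle).toAlgebra
  have : IsScalarTower (fixedField (⊤ : Subgroup (L ≃ₐ[K] L))) (perfectClosure K L) L :=
    IsScalarTower.of_algebraMap_eq fun _ => rfl
  have : IsGalois (fixedField (⊤ : Subgroup (L ≃ₐ[K] L))) L :=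
    inferInstanceAs (IsGalois (FixedPoints.subfield (⊤ : Subgroup (L ≃ₐ[K] L)) L) L)
  exact Algebra.isSeparable_tower_top_of_isSeparable
    (fixedField (⊤ : Subgroup (L ≃ₐ[K] L))) (perfectClosure K L) L

/-- Over the compositum, `L` is both separable and purely inseparable. -/
theorem separableClosure_sup_perfectClosure [FiniteDimensional K L] [Normal K L] :
    separableClosure K L ⊔ perfectClosure K L = ⊤ := by
  set M := separableClosure K L ⊔ perfectClosure K L
  have h₁ : Algebra.IsSeparable M L := by
    have := isSeparable_perfectClosure_of_normal (K := K) (L := L)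
    let _ := (inclusion (le_sup_right : perfectClosure K L ≤ M)).toAlgebra
    have : IsScalarTower (perfectClosure K L) M L := IsScalarTower.of_algebraMap_eq fun _ => rfl
    exact Algebra.isSeparable_tower_top_of_isSeparable (perfectClosure K L) M L
  have h₂ : IsPurelyInseparable M L := by
    let _ := (inclusion (le_sup_left : separableClosure K L ≤ M)).toAlgebra
    have : IsScalarTower (separableClosure K L) M L := IsScalarTower.of_algebraMap_eq fun _ => rfl
    exact IsPurelyInseparable.tower_top (separableClosure K L) M L
  rw [eq_top_iff]
  rintro x -
  obtain ⟨y, rfl⟩ := IsPurelyInseparable.surjective_algebraMap_of_isSeparable M L x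
  exact y.2

/-- In a finite normal extension an element with separable `p ^ n`-th power is a combination, with
separable coefficients, of `p ^ n`-th roots of elements of the ground field. -/
theorem mem_span_separableClosure_of_isSeparable_pow [FiniteDimensional K L] [Normal K L] (p : ℕ)
    [ExpChar K p] (n : ℕ) {x : L} (hx : IsSeparable K (x ^ p ^ n)) :
    x ∈ Submodule.span (separableClosure K L) {y : L | y ^ p ^ n ∈ (algebraMap K L).range} := by
  have hL : ExpChar L p := expChar_of_injective_algebraMap (algebraMap K L).injective p
  let S := separableClosure K L
  let I := perfectClosure K L
  have hd : S.LinearDisjoint I := linearDisjoint_of_isPurelyInseparable_of_isSeparable I S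
  have htop : S.toSubalgebra ⊔ I.toSubalgebra = ⊤ := by
    rw [← sup_toSubalgebra_of_left, separableClosure_sup_perfectClosure, top_toSubalgebra]
  let b := Module.finBasis K S
  -- As `S / K` is separable, the `p ^ n`-th powers of a `K`-basis again form a basis. The
  -- coordinates of `x ^ p ^ n` in it are the `p ^ n`-th powers of those of `x`, and they lie in `K`
  -- because `x ^ p ^ n ∈ S`.
  let b' := b.mapPowExpCharPowOfIsSeparable p n
  have hb' (j) : b' j = b j ^ p ^ n := by
    simp [b', Module.Basis.mapPowExpCharPowOfIsSeparable]
  let B := hd.basisOfBasisLeft htop b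
  let B' := hd.basisOfBasisLeft htop b'
  have hxB := B.sum_repr x
  have key : B'.equivFun (x ^ p ^ n) = fun j => B.repr x j ^ p ^ n := by
    rw [← LinearEquiv.eq_symm_apply, B'.equivFun_symm_apply]
    conv_lhs => rw [← hxB]
    rw [sum_pow_char_pow]
    refine Finset.sum_congr rfl fun j _ => ?_
    simp only [B, B', LinearDisjoint.basisOfBasisLeft_apply, hb', map_pow, Algebra.smul_def, mul_pow]
  rw [← hxB]
  refine Submodule.sum_mem _ fun j _ => ?_
  have : B.repr x j • B j = b j • (B.repr x j : L) := by
    simp only [B, LinearDisjoint.basisOfBasisLeft_apply, Algebra.smul_def]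
    exact mul_comm _ _
  rw [this]
  refine Submodule.smul_mem _ _ (Submodule.subset_span ⟨b'.repr ⟨x ^ p ^ n, hx⟩ j, ?_⟩)
  have h := hd.basisOfBasisLeft_repr_apply htop b' ⟨x ^ p ^ n, hx⟩ j
  rw [← h]
  change ((B'.equivFun (x ^ p ^ n) j : I) : L) = _
  rw [key]
  rfl

end Normal

/-! ### Degree counts for tensor products -/

section Finrank

variable {K : Type*} [Field K] {r : ℕ} {E₀ : Type*} [Field E₀] [Algebra K E₀]
  {E : Fin r → Type*} [∀ i, Field (E i)] [∀ i, Algebra K (E i)]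
  {L : Type*} [Field L] [Algebra K L]

theorem PiTensorProduct.finrank_eq_prod [∀ i, FiniteDimensional K (E i)] :
    Module.finrank K (⨂[K] i, E i) = ∏ i, Module.finrank K (E i) := by
  rw [Module.finrank_eq_card_basis (Basis.piTensorProduct fun i => Module.finBasis K (E i))]
  simp

theorem finrank_eq_prod_of_bijective [∀ i, FiniteDimensional K (E i)]
    (f : (⨂[K] i, E i) →ₗ[K] L) (hf : Function.Bijective f) :
    Module.finrank K L = ∏ i, Module.finrank K (E i) := by
  rw [← (LinearEquiv.ofBijective f hf).finrank_eq, PiTensorProduct.finrank_eq_prod]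

theorem tensorMul_bijective_of_surjective [∀ i, FiniteDimensional K (E i)]
    [FiniteDimensional K E₀] {ι₀ : E₀ →ₐ[K] L} {ι : ∀ i, E i →ₐ[K] L}
    (h : Function.Surjective (tensorMul ι₀ ι))
    (hle : Module.finrank K E₀ * ∏ i, Module.finrank K (E i) ≤ Module.finrank K L) :
    Function.Bijective (tensorMul ι₀ ι) ∧
      Module.finrank K L = Module.finrank K E₀ * ∏ i, Module.finrank K (E i) := by
  rw [← PiTensorProduct.finrank_eq_prod, ← Module.finrank_tensorProduct] at hle ⊢
  have : Module.Finite K L := Module.Finite.of_surjective _ h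
  have heq := hle.antisymm (LinearMap.finrank_le_finrank_of_surjective h)
  exact ⟨⟨(LinearMap.injective_iff_surjective_of_finrank_eq_finrank heq).2 h, h⟩, heq.symm⟩

end Finrank

/-! ### Existence of a decomposition -/

section Existence

variable {K L : Type*} [Field K] [Field L] [Algebra K L]

theorem adjoin_range_eq_top_of_surjective {r : ℕ} {α : Fin r → L}
    (h : Function.Surjective (adjoinTensorMul (K := K) α)) : adjoin K (Set.range α) = ⊤ := by
  rw [eq_top_iff]
  rintro z -
  obtain ⟨z, rfl⟩ := h z
  induction z using PiTensorProduct.induction_on with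
  | smul_tprod c y =>
    rw [map_smul]
    refine IntermediateField.smul_mem _ ?_
    have : adjoinTensorMul (K := K) α (PiTensorProduct.tprod K y) = ∏ i, (y i : L) := by
      simp [adjoinTensorMul]
    rw [this]
    refine _root_.prod_mem fun i _ => ?_
    have : K⟮α i⟯ ≤ adjoin K (Set.range α) :=
      adjoin_simple_le_iff.2 (subset_adjoin K _ (Set.mem_range_self i))
    exact this (y i).2
  | add y z hy hz => rw [map_add]; exact add_mem hy hz

variable [FiniteDimensional K L]

/-- An embedding of `L` into an algebraic closure is determined by its restrictions to the `K(αᵢ)`.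
-/
theorem finSepDegree_le_prod {r : ℕ} {α : Fin r → L} (h : adjoin K (Set.range α) = ⊤) :
    Field.finSepDegree K L ≤ ∏ i, Field.finSepDegree K K⟮α i⟯ := by
  simp_rw [Field.finSepDegree_eq_of_isAlgClosed K _ (AlgebraicClosure L)]
  rw [← Nat.card_pi]
  refine Nat.card_le_card_of_injective
    (fun (σ : L →ₐ[K] AlgebraicClosure L) i => σ.comp K⟮α i⟯.val) fun σ τ hστ => ?_
  have htop : Algebra.adjoin K (Set.range α) = ⊤ :=
    (adjoin_eq_top_iff_of_isAlgebraic fun x _ => Algebra.IsAlgebraic.isAlgebraic x).1 h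
  refine AlgHom.ext_of_adjoin_eq_top htop ?_
  rintro _ ⟨i, rfl⟩
  exact AlgHom.congr_fun (congrFun hστ i) (AdjoinSimple.gen K (α i))

/-- Degrees multiply and the separable degree is at most the product, so the inseparable degree is
at least the product. -/
theorem prod_finInsepDegree_le {r : ℕ} {α : Fin r → L}
    (h : Function.Bijective (adjoinTensorMul (K := K) α)) :
    ∏ i, Field.finInsepDegree K K⟮α i⟯ ≤ Field.finInsepDegree K L := by
  have hfin : Module.finrank K L = ∏ i, Module.finrank K K⟮α i⟯ :=
    finrank_eq_prod_of_bijective _ h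
  have hs := finSepDegree_le_prod (adjoin_range_eq_top_of_surjective h.2)
  simp_rw [← Field.finSepDegree_mul_finInsepDegree K K⟮_⟯] at hfin
  rw [← Field.finSepDegree_mul_finInsepDegree, Finset.prod_mul_distrib] at hfin
  refine Nat.le_of_mul_le_mul_left ?_ (Nat.pos_of_ne_zero (NeZero.ne (Field.finSepDegree K L)))
  rw [hfin]
  exact Nat.mul_le_mul_right _ hs

theorem tensorMul_surjective_of_adjoin_eq_top {F : IntermediateField K L} {θ : L}
    (hθ : K⟮θ⟯ = F) {r : ℕ} {β : Fin r → L} (hβ : adjoin F (Set.range β) = ⊤) :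
    Function.Surjective (tensorMul K⟮θ⟯.val fun i => K⟮β i⟯.val) := by
  refine tensorMul_surjective (eq_top_iff.2 fun z _ => ?_)
  have hz : z ∈ Algebra.adjoin F (Set.range β) := by
    rw [← adjoin_toSubalgebra, hβ]
    trivial
  induction hz using Algebra.adjoin_induction with
  | mem x hx =>
    obtain ⟨i, rfl⟩ := hx
    exact Algebra.mem_sup_right ((le_iSup (fun i => (K⟮β i⟯.val).range) i)
      ⟨AdjoinSimple.gen K (β i), rfl⟩)
  | algebraMap c =>
    exact Algebra.mem_sup_left ⟨⟨c, hθ ▸ c.2⟩, rfl⟩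
  | add x y _ _ hx hy => exact add_mem (hx trivial) (hy trivial)
  | mul x y _ _ hx hy => exact mul_mem (hx trivial) (hy trivial)

/-- A separable element and `p ^ nᵢ`-th roots which generate `L`, of large enough total degree,
form a decomposition of `L`. -/
theorem nonempty_modularDecomposition_of_generators {p : ℕ} (hp : p.Prime)
    {F : IntermediateField K L} {θ : L} (hsep : IsSeparable K θ) (hθ : K⟮θ⟯ = F) {r : ℕ}
    {β : Fin r → L} {n : Fin r → ℕ} {a : Fin r → K}
    (ha : ∀ i, algebraMap K L (a i) = β i ^ p ^ n i) (hβ : adjoin F (Set.range β) = ⊤)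
    (hL : Module.finrank K K⟮θ⟯ * ∏ i, p ^ n i ≤ Module.finrank K L) :
    Nonempty (ModularDecomposition K L p) := by
  have hroot (i) : aeval (β i) (X ^ p ^ n i - C (a i)) = 0 := by simp [ha]
  have hdvd (i) : minpoly K (β i) ∣ X ^ p ^ n i - C (a i) := minpoly.dvd _ _ (hroot i)
  have hle (i) : Module.finrank K K⟮β i⟯ ≤ p ^ n i := by
    rw [adjoin.finrank (.of_finite K (β i)), ← natDegree_X_pow_sub_C (n := p ^ n i) (r := a i)]
    exact natDegree_le_of_dvd (hdvd i) (X_pow_sub_C_ne_zero (pow_pos hp.pos _) _)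
  obtain ⟨hbij, heq⟩ := tensorMul_bijective_of_surjective (tensorMul_surjective_of_adjoin_eq_top hθ hβ)
    ((Nat.mul_le_mul_left _ (Finset.prod_le_prod' fun i _ => hle i)).trans hL)
  rw [heq] at hL
  -- Together with the factorwise bound `hle`, this forces equality in every factor.
  have hprod : ∏ i, p ^ n i ≤ ∏ i, Module.finrank K K⟮β i⟯ :=
    Nat.le_of_mul_le_mul_left hL Module.finrank_pos
  have hdeg : ∀ i, Module.finrank K K⟮β i⟯ = p ^ n i := by
    by_contra! h
    obtain ⟨i, hi⟩ := h
    exact hprod.not_gt (Finset.prod_lt_prod (fun _ _ => Module.finrank_pos) (fun i _ => hle i)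
      ⟨i, Finset.mem_univ i, (hle i).lt_of_ne hi⟩)
  exact ⟨{
    α₀ := θ
    m := r
    α := β
    n := n
    a := a
    separable := hsep
    minpoly_eq := fun i => (eq_of_monic_of_dvd_of_natDegree_le (minpoly.monic (.of_finite K _))
      (monic_X_pow_sub_C _ (pow_ne_zero _ hp.ne_zero)) (hdvd i) (by
        rw [natDegree_X_pow_sub_C, ← adjoin.finrank (.of_finite K (β i)), hdeg])).symm
    bijective := hbij }⟩

/-- A finite normal modular extension of characteristic `p` has a decomposition into a separable
factor and purely inseparable factors. -/
theorem IsModularExtension.nonempty_modularDecomposition (p : ℕ) [Fact p.Prime] [CharP K p]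
    [Normal K L] (hmod : IsModularExtension K L) : Nonempty (ModularDecomposition K L p) := by
  have hp : p.Prime := Fact.out
  have hK : ExpChar K p := inferInstance
  obtain ⟨r, α, hα⟩ := hmod
  choose n hn using fun i => finInsepDegree_eq_pow (F := K) (E := K⟮α i⟯) p
  let S := separableClosure K L
  have : CharP S p := charP_of_injective_algebraMap (algebraMap K S).injective p
  have hαS : adjoin S (Set.range α) = ⊤ := by
    rw [← restrictScalars_eq_top_iff (K := K), restrictScalars_adjoin_eq_sup,
      adjoin_range_eq_top_of_surjective hα.2, sup_top_eq]
  obtain ⟨β, hβ, hβtop⟩ := IsPurelyInseparable.exists_adjoin_range_eq_top p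
    (Y := fun i => {y : L | y ^ p ^ n i ∈ (algebraMap K L).range}) hαS
    (fun i => ⟨1, by simp⟩)
    (fun i => mem_span_separableClosure_of_isSeparable_pow p (n i) (by
      have := pow_finInsepDegree_isSeparable p (F := K) (AdjoinSimple.gen K (α i))
      rw [hn] at this
      have h := (isSeparable_map_iff K⟮α i⟯.val K⟮α i⟯.val.injective).2 this
      rwa [map_pow] at h))
  choose a ha using hβ
  obtain ⟨θ, hθ⟩ := Field.exists_primitive_element K S
  have hθS : K⟮(θ : L)⟯ = S := by
    rw [← lift_adjoin_simple, hθ, lift_top]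
  have hL : Module.finrank K K⟮(θ : L)⟯ * ∏ i, p ^ n i ≤ Module.finrank K L := by
    have h : ∏ i, p ^ n i ≤ Module.finrank S L :=
      (Finset.prod_congr rfl fun i _ => (hn i).symm).trans_le (prod_finInsepDegree_le hα)
    rw [← Module.finrank_mul_finrank K S L, hθS]
    exact Nat.mul_le_mul_left _ h
  exact nonempty_modularDecomposition_of_generators hp (mem_separableClosure_iff.1 θ.2) hθS ha
    hβtop hL

end Existence

end

theorem mainTheorem1 (p : ℕ) [Fact p.Prime] {K : Type*} {L : Type*} [Field K] [CharP K p] [Field L]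
    [Algebra K L] [FiniteDimensional K L] [Normal K L] (hmod : IsModularExtension K L)
    (e : ℕ) (he : ∀ x : L, IsSeparable K (x ^ p ^ e)) :
    Nonempty (ModularDecomposition K L p) ∧
      ∀ (D : ModularDecomposition K L p) (V : Type*) [AddCommGroup V] [Module K V]
        (W : Submodule L (L ⊗[K] V)),
        List.TFAE [IsDefinedOver W, D.IsGHAStable W, IsHeeremaGaloisStable (p ^ e) W] := by
  exact ⟨hmod.nonempty_modularDecomposition p, fun D V _ _ W => D.tfae_isDefinedOver he W⟩
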